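/- Let $A$ be a finite set with the discrete topology, and let $(\mathbf w_n)_{n\ge 1}$ be a sequence of nonempty finite words over $A$ whose lengths satisfy $|\mathbf w_n|\to\infty$. Notation. For words $\mathbf v=(v_1,\dots,v_k)\in A^k$, $k\ge 1$, and $\mathbf w=(w_1,\dots,w_m)\in A^m$ with $m\ge k$, the subsequence density of $\mathbf v$ in $\mathbf w$ is $$t(\mathbf v,\mathbf w)=\binom{m}{k}^{-1}\#\{1\le j_1<\dots<j_k\le m:\ w_{j_i}=v_i\text{ for all }1\le i\le k\}.$$ For a nonempty word $\mathbf w=(w_1,\dots,w_m)$ let $\rho_{\mathbf w}=\frac1m\sum_{j=1}^m\delta_{(w_j,\,j/m)}$, a probability measure on $A\times\mathbb R$. Let $\mathcal C(A)$ be the set of probability measures $\rho$ on $A\times\mathbb R$ with $\rho(A\times[0,t])=t$ for all $t\in[0,1]$. For a probability measure $\rho$ on $A\times\mathbb R$ and $k\ge1$, let $\mathrm{SPREAD}(\rho,k)$ be the law on $A^k$ of $(Y_{\pi(1)},\dots,Y_{\pi(k)})$, where $(Y_1,X_1),\dots,(Y_k,X_k)$ are i.i.d. with law $\rho$ and $\pi$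 is the permutation of $\{1,\dots,k\}$ that sorts $X_1,\dots,X_k$ in nondecreasing order, with ties kept in their original order. The following two statements are equivalent: (i) $t(\mathbf v,\mathbf w_n)$ converges in $\mathbb R$ as $n\to\infty$ for each $k\ge 1$ and each word $\mathbf v\in A^k$. (ii) $\rho_{\mathbf w_n}$ converges weakly as $n\to\infty$ to some $\rho\in\mathcal C(A)$. If (i) and (ii) hold, with $\rho$ the limit in (ii), then $\lim_{n\to\infty}t(\mathbf v,\mathbf w_n)=\mathrm{SPREAD}(\rho,k)(\{\mathbf v\})$ for each $k\ge1$ and each $\mathbf v\in A^k$. -/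

import Mathlib

open Filter MeasureTheory
open scoped Topology ENNReal NNReal

namespace WordLimits

/-- The number of embeddings of the word `v` (of length `k`) into the word `w` (of length `n`) as a
subsequence: strictly increasing position maps `j` with `w (j i) = v i` for all `i`. -/
noncomputable def subseqCount {A : Type*} {k n : ℕ} (v : Fin k → A) (w : Fin n → A) : ℕ :=
  Nat.card {j : Fin k ↪o Fin n // ∀ i, w (j i) = v i}

/-- The subsequence density of `v` in `w`. -/
noncomputable def density {A : Type*} {k n : ℕ} (v : Fin k → A) (w : Fin n → A) : ℝ :=
  (subseqCount v w : ℝ) / (n.choose k : ℝ)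

/-- `(1/n) ∑_{j=1}^n δ_{(w_j, j/n)}` as a measure (positions in `Fin n` start at `0`). -/
noncomputable def wordMeasureAux {A : Type*} [MeasurableSpace A] {n : ℕ} (w : Fin n → A) :
    Measure (A × ℝ) :=
  (n : ℝ≥0∞)⁻¹ • ∑ j : Fin n, Measure.dirac (w j, (((j : ℕ) : ℝ) + 1) / (n : ℝ))

theorem isProbabilityMeasure_wordMeasureAux {A : Type*} [MeasurableSpace A] {n : ℕ} [NeZero n]
    (w : Fin n → A) : IsProbabilityMeasure (wordMeasureAux w) := by
  constructor
  have hn : (n : ℝ≥0∞) ≠ 0 := by exact_mod_cast NeZero.ne n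
  simp [wordMeasureAux, ENNReal.inv_mul_cancel hn (ENNReal.natCast_ne_top n)]

/-- The probability measure `ρ_w = (1/n) ∑_{j=1}^n δ_{(w_j, j/n)}` of a nonempty word `w`. -/
noncomputable def wordMeasure {A : Type*} [MeasurableSpace A] {n : ℕ} [NeZero n]
    (w : Fin n → A) : ProbabilityMeasure (A × ℝ) :=
  ⟨wordMeasureAux w, isProbabilityMeasure_wordMeasureAux w⟩

/-- The probability measures on `A × ℝ` whose second marginal is uniform on `[0,1]`. -/
def uniformSecondMarginal (A : Type*) [MeasurableSpace A] : Set (ProbabilityMeasure (A × ℝ)) :=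
  {ρ | ∀ t ∈ Set.Icc (0 : ℝ) 1,
    (ρ : Measure (A × ℝ)) (Set.univ ×ˢ Set.Icc (0 : ℝ) t) = ENNReal.ofReal t}

/-- Induced order statistics `(y_{π(1)}, …, y_{π(k)})`, where `π` is the permutation that sorts
`x` increasingly and stably (`Tuple.sort` breaks ties by position). -/
noncomputable def inducedOrderStat {A : Type*} {k : ℕ} (y : Fin k → A) (x : Fin k → ℝ) : Fin k → A :=
  fun i => y (Tuple.sort x i)

theorem measurable_sort (k : ℕ) :
    @Measurable _ _ _ ⊤ (fun x : Fin k → ℝ => Tuple.sort x) := by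
  let _ : MeasurableSpace (Equiv.Perm (Fin k)) := ⊤
  refine measurable_to_countable' fun σ => ?_
  have : (fun x : Fin k → ℝ => Tuple.sort x) ⁻¹' {σ} =
      {x | (∀ i j, i ≤ j → x (σ i) ≤ x (σ j)) ∧
        ∀ i j, i < j → x (σ i) = x (σ j) → σ i < σ j} := by
    ext x
    simp only [Set.mem_preimage, Set.mem_singleton_iff, Set.mem_ofPred_eq]
    rw [eq_comm, Tuple.eq_sort_iff]
    rfl
  rw [this]
  measurability

theorem measurable_inducedOrderStat {A : Type*} [MeasurableSpace A] (k : ℕ) :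
    Measurable (fun p : Fin k → A × ℝ =>
      inducedOrderStat (fun i => (p i).1) (fun i => (p i).2)) := by
  let _ : MeasurableSpace (Equiv.Perm (Fin k)) := ⊤
  have h1 : Measurable (fun p : Fin k → A × ℝ => Tuple.sort (fun i => (p i).2)) :=
    (measurable_sort k).comp (by fun_prop)
  have h2 : Measurable (fun q : (Fin k → A × ℝ) × Equiv.Perm (Fin k) =>
      fun i => (q.1 (q.2 i)).1) :=
    measurable_from_prod_countable_left fun σ =>
      measurable_pi_lambda _ fun i => (measurable_pi_apply (σ i)).fst
  exact h2.comp (measurable_id.prodMk h1)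

/-- `SPREAD(ρ,k)`: the law of the induced order statistics of `Y_1, …, Y_k` with respect to
`X_1, …, X_k`, where `(Y_1,X_1), …, (Y_k,X_k)` are i.i.d. with law `ρ`. -/
noncomputable def spread {A : Type*} [MeasurableSpace A] (ρ : ProbabilityMeasure (A × ℝ)) (k : ℕ) :
    ProbabilityMeasure (Fin k → A) :=
  ⟨(Measure.pi fun _ : Fin k => (ρ : Measure (A × ℝ))).map
      (fun p => inducedOrderStat (fun i => (p i).1) (fun i => (p i).2)),
    Measure.isProbabilityMeasure_map (measurable_inducedOrderStat k).aemeasurable⟩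

end WordLimits

namespace WordLimits

/-! ### The uniform marginal -/

/-! The link between densities and measures is an exact identity: an occurrence of `v` in `w` is an
atom of the `k`-fold power of the empirical measure lying in `orderedSet v`, so the density is `n ^
k / n.choose k` times the mass of that set (`pi_wordMeasureAux_orderedSet`). The factor tends to
`k!`. The frontier of `orderedSet v` forces two equal positions, which is a null event under a
uniform marginal, so weak convergence passes to the masses; the limit is the spread, by
exchangeability (`spread_singleton`).

For the converse, all empirical measures live on the compact set `A × [0,1]`, so cluster points
exist. Each one has uniform marginal, and its spreads are the given density limits. Spreads
determine the measure: the law of the last letter among `r + 1` samples gives the `r`-th moment of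
each letter's fibre (`sum_spread_last`), and moments determine a measure on `[0,1]`. The cluster
point is therefore unique, and compactness gives convergence. -/

theorem map_snd_eq_of_mem_uniformSecondMarginal {A : Type*} [MeasurableSpace A]
    {ρ : ProbabilityMeasure (A × ℝ)} (hρ : ρ ∈ uniformSecondMarginal A) :
    (ρ : Measure (A × ℝ)).map Prod.snd = volume.restrict (Set.Icc (0 : ℝ) 1) := by
  set μ := (ρ : Measure (A × ℝ)).map Prod.snd with hμ
  have : IsProbabilityMeasure μ := Measure.isProbabilityMeasure_map measurable_snd.aemeasurable
  have hIcc : ∀ t ∈ Set.Icc (0 : ℝ) 1, μ (Set.Icc 0 t) = ENNReal.ofReal t := by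
    intro t ht
    rw [hμ, Measure.map_apply measurable_snd measurableSet_Icc, ← Set.univ_prod]
    exact hρ t ht
  have hae : ∀ᵐ x ∂μ, x ∈ Set.Icc (0 : ℝ) 1 := by
    change Set.Icc (0 : ℝ) 1 ∈ ae μ
    rw [mem_ae_iff_prob_eq_one measurableSet_Icc, hIcc 1 ⟨zero_le_one, le_rfl⟩, ENNReal.ofReal_one]
  refine Measure.ext_of_Iic _ _ fun t => ?_
  have h1 : μ (Set.Iic t) = μ (Set.Iic t ∩ Set.Icc 0 1) := by
    refine measure_congr ?_
    filter_upwards [hae] with x hx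
    exact propext ⟨fun h => ⟨h, hx⟩, fun h => h.1⟩
  have h2 : Set.Iic t ∩ Set.Icc (0 : ℝ) 1 = Set.Icc 0 (min t 1) := by
    ext x; simp; tauto
  rw [h1, Measure.restrict_apply measurableSet_Iic, h2, Real.volume_Icc, sub_zero]
  rcases lt_or_ge t 0 with ht | ht
  · rw [Set.Icc_eq_empty (by simp [ht]), measure_empty, ENNReal.ofReal_of_nonpos]
    exact (min_le_left _ _).trans ht.le
  · exact hIcc _ ⟨le_min ht zero_le_one, min_le_right _ _⟩

section Uniform

variable {A : Type*} [MeasurableSpace A] {ρ : Measure (A × ℝ)}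

theorem ae_snd_mem_Icc (hρ : ρ.map Prod.snd = volume.restrict (Set.Icc (0 : ℝ) 1)) :
    ∀ᵐ p ∂ρ, p.2 ∈ Set.Icc (0 : ℝ) 1 := by
  have : ∀ᵐ x ∂(ρ.map Prod.snd), x ∈ Set.Icc (0 : ℝ) 1 := by
    rw [hρ]; exact ae_restrict_mem measurableSet_Icc
  exact ae_of_ae_map measurable_snd.aemeasurable this

theorem measure_snd_eq_const (hρ : ρ.map Prod.snd = volume.restrict (Set.Icc (0 : ℝ) 1)) (c : ℝ) :
    ρ {p | p.2 = c} = 0 := by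
  have : (ρ.map Prod.snd) {c} = 0 := by rw [hρ]; simp
  rwa [Measure.map_apply measurable_snd (measurableSet_singleton c)] at this

theorem measure_snd_lt (hρ : ρ.map Prod.snd = volume.restrict (Set.Icc (0 : ℝ) 1)) {c : ℝ}
    (hc : c ∈ Set.Icc (0 : ℝ) 1) : ρ {p | p.2 < c} = ENNReal.ofReal c := by
  have : (ρ.map Prod.snd) (Set.Iio c) = ENNReal.ofReal c := by
    rw [hρ, Measure.restrict_apply measurableSet_Iio]
    have : Set.Iio c ∩ Set.Icc 0 1 = Set.Ico 0 c := by
      ext x; simp only [Set.mem_inter_iff, Set.mem_Iio, Set.mem_Icc, Set.mem_Ico]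
      constructor
      · rintro ⟨h1, h2, h3⟩; exact ⟨h2, h1⟩
      · rintro ⟨h1, h2⟩; exact ⟨h2, h1, h2.le.trans hc.2⟩
    rw [this]; simp
  rwa [Measure.map_apply measurable_snd measurableSet_Iio] at this

theorem ae_injective_snd [IsProbabilityMeasure ρ]
    (hρ : ρ.map Prod.snd = volume.restrict (Set.Icc (0 : ℝ) 1)) (k : ℕ) :
    ∀ᵐ p ∂(Measure.pi fun _ : Fin k => ρ), Function.Injective fun i => (p i).2 := by
  have key : ∀ i j : Fin k, i ≠ j →
      ∀ᵐ p ∂(Measure.pi fun _ : Fin k => ρ), (p i).2 ≠ (p j).2 := by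
    intro i j hij
    obtain _ | k := k
    · exact i.elim0
    -- Split off coordinate `i`; by Fubini, once the other coordinates are fixed, the `i`-th
    -- position must hit a single point, which has mass zero.
    obtain ⟨l, rfl⟩ := Fin.exists_succAbove_eq hij.symm
    have hmp := measurePreserving_piFinSuccAbove (fun _ : Fin (k + 1) => ρ) i
    have : ∀ᵐ q ∂(ρ.prod (Measure.pi fun _ : Fin k => ρ)), q.1.2 ≠ (q.2 l).2 := by
      have hm : MeasurableSet {q : (A × ℝ) × (Fin k → A × ℝ) | q.1.2 = (q.2 l).2} :=
        measurableSet_eq_fun (by fun_prop) (by fun_prop)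
      rw [ae_iff]
      simp only [ne_eq, not_not]
      rw [Measure.prod_apply_symm hm]
      simp only [Set.preimage_ofPred_eq]
      simp [measure_snd_eq_const hρ]
    exact hmp.quasiMeasurePreserving.ae this
  have : ∀ᵐ p ∂(Measure.pi fun _ : Fin k => ρ), ∀ i j : Fin k, i ≠ j → (p i).2 ≠ (p j).2 := by
    rw [ae_all_iff]; intro i
    rw [ae_all_iff]; intro j
    by_cases hij : i = j
    · simp [hij]
    · simpa [hij] using key i j hij
  filter_upwards [this] with p hp i j hij
  by_contra h
  exact hp i j h hij

end Uniform

/-! ### Positions in increasing order spelling a given word -/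

/-- The `k`-tuples of points of `A × ℝ` with strictly increasing second coordinates whose first
coordinates spell the word `v`. -/
def orderedSet {A : Type*} {k : ℕ} (v : Fin k → A) : Set (Fin k → A × ℝ) :=
  {p | (∀ i, (p i).1 = v i) ∧ StrictMono fun i => (p i).2}

section OrderedSet

variable {A : Type*} {k : ℕ}

theorem isOpen_orderedSet [TopologicalSpace A] [DiscreteTopology A] (v : Fin k → A) :
    IsOpen (orderedSet v) := by
  have : orderedSet v = (⋂ i, {p : Fin k → A × ℝ | (p i).1 ∈ ({v i} : Set A)}) ∩
      ⋂ i, ⋂ j, ⋂ _ : i < j, {p : Fin k → A × ℝ | (p i).2 < (p j).2} := by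
    ext p; simp [orderedSet, StrictMono]
  rw [this]
  refine IsOpen.inter (isOpen_iInter_of_finite fun i => ?_)
    (isOpen_iInter_of_finite fun i => isOpen_iInter_of_finite fun j =>
      isOpen_iInter_of_finite fun _ => ?_)
  · exact (isOpen_discrete {v i}).preimage (f := fun p : Fin k → A × ℝ => (p i).1) (by fun_prop)
  · exact isOpen_lt (by fun_prop) (by fun_prop)

/-- The closure only relaxes strict to weak monotonicity, and a monotone injective tuple is already
strictly monotone, hence in the open set itself. -/
theorem frontier_orderedSet_subset [TopologicalSpace A] [DiscreteTopology A] (v : Fin k → A) :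
    frontier (orderedSet v) ⊆ {p | ¬ Function.Injective fun i => (p i).2} := by
  set C := {p : Fin k → A × ℝ | (∀ i, (p i).1 = v i) ∧ Monotone fun i => (p i).2} with hC
  have hcl : IsClosed C := by
    have : C = (⋂ i, {p : Fin k → A × ℝ | (p i).1 ∈ ({v i} : Set A)}) ∩
        ⋂ i, ⋂ j, ⋂ _ : i ≤ j, {p : Fin k → A × ℝ | (p i).2 ≤ (p j).2} := by
      ext p; simp [hC, Monotone]
    rw [this]
    refine IsClosed.inter (isClosed_iInter fun i => ?_)
      (isClosed_iInter fun i => isClosed_iInter fun j => isClosed_iInter fun _ => ?_)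
    · exact (isClosed_discrete {v i}).preimage (f := fun p : Fin k → A × ℝ => (p i).1)
        (by fun_prop)
    · exact isClosed_le (by fun_prop) (by fun_prop)
  have hsub : orderedSet v ⊆ C := fun p hp => ⟨hp.1, hp.2.monotone⟩
  intro p hp hinj
  rw [(isOpen_orderedSet v).frontier_eq] at hp
  have := closure_minimal hsub hcl hp.1
  exact hp.2 ⟨this.1, this.2.strictMono_of_injective hinj⟩

theorem inducedOrderStat_eq_iff (v : Fin k → A) {p : Fin k → A × ℝ}
    (hp : Function.Injective fun i => (p i).2) :
    inducedOrderStat (fun i => (p i).1) (fun i => (p i).2) = v ↔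
      ∃ σ : Equiv.Perm (Fin k), p ∘ σ ∈ orderedSet v := by
  constructor
  · rintro rfl
    exact ⟨Tuple.sort fun i => (p i).2, fun i => rfl,
      (Tuple.monotone_sort _).strictMono_of_injective (hp.comp (Equiv.injective _))⟩
  · rintro ⟨σ, h1, h2⟩
    have : σ = Tuple.sort fun i => (p i).2 :=
      Tuple.eq_sort_iff.2 ⟨h2.monotone, fun i j hij h => (h2 hij |>.ne h).elim⟩
    funext i
    rw [inducedOrderStat, ← this, ← h1 i]; rfl

theorem perm_eq_of_comp_mem_orderedSet {v : Fin k → A} {p : Fin k → A × ℝ}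
    {σ τ : Equiv.Perm (Fin k)} (hσ : p ∘ σ ∈ orderedSet v) (hτ : p ∘ τ ∈ orderedSet v) :
    σ = τ := by
  have key : ∀ {σ : Equiv.Perm (Fin k)}, p ∘ σ ∈ orderedSet v →
      σ = Tuple.sort fun i => (p i).2 := fun {σ} h =>
    Tuple.eq_sort_iff.2 ⟨h.2.monotone, fun i j hij h' => (h.2 hij |>.ne h').elim⟩
  rw [key hσ, key hτ]

end OrderedSet

/-- Off the null event of ties, exactly one permutation sorts the sample. The event is thus a
disjoint union of `k!` permuted copies of `orderedSet v`, all of equal mass since the samples are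
i.i.d. -/
theorem spread_singleton {A : Type*} [Finite A] [TopologicalSpace A] [DiscreteTopology A]
    [MeasurableSpace A] [BorelSpace A] {ρ : ProbabilityMeasure (A × ℝ)}
    (hρ : (ρ : Measure (A × ℝ)).map Prod.snd = volume.restrict (Set.Icc (0 : ℝ) 1))
    {k : ℕ} (v : Fin k → A) :
    (spread ρ k : Measure (Fin k → A)) {v} =
      k.factorial * Measure.pi (fun _ : Fin k => (ρ : Measure (A × ℝ))) (orderedSet v) := by
  have hm : MeasurableSet (orderedSet v) := (isOpen_orderedSet v).measurableSet
  have hcomp : ∀ σ : Equiv.Perm (Fin k),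
      Measurable fun p : Fin k → A × ℝ => p ∘ σ := fun σ =>
    measurable_pi_lambda _ fun i => measurable_pi_apply _
  have hσ : ∀ σ : Equiv.Perm (Fin k),
      Measure.pi (fun _ : Fin k => (ρ : Measure (A × ℝ))) ((fun p => p ∘ σ) ⁻¹' orderedSet v) =
        Measure.pi (fun _ : Fin k => (ρ : Measure (A × ℝ))) (orderedSet v) := by
    intro σ
    have := measurePreserving_piCongrLeft (fun _ : Fin k => (ρ : Measure (A × ℝ))) σ.symm
    have h2 := this.measure_preimage hm.nullMeasurableSet
    convert h2 using 2
    ext p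
    have : (MeasurableEquiv.piCongrLeft (fun _ : Fin k => A × ℝ) σ.symm) p = p ∘ σ := by
      funext i
      obtain ⟨j, rfl⟩ := σ.symm.surjective i
      simp [MeasurableEquiv.coe_piCongrLeft]
    simp [this]
  have h1 : (spread ρ k : Measure (Fin k → A)) {v} =
      Measure.pi (fun _ : Fin k => (ρ : Measure (A × ℝ)))
        (⋃ σ : Equiv.Perm (Fin k), (fun p => p ∘ σ) ⁻¹' orderedSet v) := by
    change (Measure.map _ _) {v} = _
    rw [Measure.map_apply (measurable_inducedOrderStat k) (measurableSet_singleton v)]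
    refine measure_congr ?_
    filter_upwards [ae_injective_snd hρ k] with p hp
    refine propext ?_
    change inducedOrderStat _ _ = v ↔ p ∈ ⋃ σ : Equiv.Perm (Fin k), _
    rw [inducedOrderStat_eq_iff v hp]
    simp
  rw [h1, measure_iUnion (fun σ τ hστ => ?_) fun σ => hcomp σ hm, tsum_fintype]
  · simp [hσ, Fintype.card_perm]
  · exact Set.disjoint_left.2 fun p h1 h2 => hστ (perm_eq_of_comp_mem_orderedSet h1 h2)

/-! ### The empirical measure of a word -/

theorem wordMeasureAux_eq_map {A : Type*} [MeasurableSpace A] {n : ℕ} (w : Fin n → A) :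
    wordMeasureAux w = ((n : ℝ≥0∞)⁻¹ • (Measure.count : Measure (Fin n))).map
      fun j => (w j, (((j : ℕ) : ℝ) + 1) / (n : ℝ)) := by
  have hm : Measurable fun j : Fin n => (w j, (((j : ℕ) : ℝ) + 1) / (n : ℝ)) :=
    measurable_of_finite _
  rw [Measure.map_smul, wordMeasureAux]
  congr 1
  ext s hs
  rw [Measure.map_apply hm hs, Measure.finsetSum_apply, Measure.count,
    Measure.sum_apply _ (hm hs), tsum_fintype]
  refine Finset.sum_congr rfl fun j _ => ?_
  rw [Measure.dirac_apply' _ hs, Measure.dirac_apply' _ (hm hs)]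
  rfl

theorem wordMeasureAux_apply {A : Type*} [MeasurableSpace A] {n : ℕ} (w : Fin n → A)
    {s : Set (A × ℝ)} (hs : MeasurableSet s) :
    wordMeasureAux w s =
      (n : ℝ≥0∞)⁻¹ * Nat.card {j : Fin n // (w j, (((j : ℕ) : ℝ) + 1) / (n : ℝ)) ∈ s} := by
  have hm : Measurable fun j : Fin n => (w j, (((j : ℕ) : ℝ) + 1) / (n : ℝ)) :=
    measurable_of_finite _
  rw [wordMeasureAux_eq_map, Measure.map_apply hm hs, Measure.smul_apply, smul_eq_mul,
    Measure.count_apply (hm hs), ← Set.Finite.cast_ncard_eq (Set.toFinite _)]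
  rfl

/-- Every position tuple is an atom of mass `n⁻ᵏ`; strictness in `orderedSet` discards repeated
positions, so the count is exact, without an error term. -/
theorem pi_wordMeasureAux_orderedSet {A : Type*} [Finite A] [TopologicalSpace A]
    [DiscreteTopology A] [MeasurableSpace A] [BorelSpace A] {n k : ℕ} [NeZero n]
    (w : Fin n → A) (v : Fin k → A) :
    Measure.pi (fun _ : Fin k => wordMeasureAux w) (orderedSet v) =
      subseqCount v w * ((n : ℝ≥0∞)⁻¹) ^ k := by
  have hn : (0 : ℝ) < n := by exact_mod_cast Nat.pos_of_neZero n
  have hn0 : (n : ℝ≥0∞) ≠ 0 := by exact_mod_cast NeZero.ne n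
  have hfin : IsFiniteMeasure ((n : ℝ≥0∞)⁻¹ • (Measure.count : Measure (Fin n))) :=
    Measure.smul_finite _ (by simp [hn0])
  set g : Fin n → A × ℝ := fun j => (w j, (((j : ℕ) : ℝ) + 1) / (n : ℝ)) with hg
  have hgm : Measurable g := measurable_of_finite _
  have hgm' : Measurable fun (x : Fin k → Fin n) i => g (x i) := measurable_of_finite _
  have : wordMeasureAux w = ((n : ℝ≥0∞)⁻¹ • (Measure.count : Measure (Fin n))).map g :=
    wordMeasureAux_eq_map w
  simp_rw [this]
  rw [← Measure.pi_map_pi fun _ => hgm.aemeasurable,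
    Measure.map_apply hgm' (isOpen_orderedSet v).measurableSet]
  set S := (fun (x : Fin k → Fin n) i => g (x i)) ⁻¹' orderedSet v with hS
  have hSfin : S.Finite := Set.toFinite S
  rw [← hSfin.coe_toFinset, ← sum_measure_singleton]
  simp only [Measure.pi_singleton, Measure.smul_apply, Measure.count_singleton, smul_eq_mul,
    mul_one, Finset.prod_const, Finset.card_univ, Fintype.card_fin, Finset.sum_const, nsmul_eq_mul]
  congr 2
  rw [subseqCount, ← Nat.card_eq_card_finite_toFinset]
  have hmem : ∀ x : Fin k → Fin n, x ∈ S ↔ StrictMono x ∧ ∀ i, w (x i) = v i := by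
    intro x
    have : (StrictMono fun i => (g (x i)).2) ↔ StrictMono x := by
      simp only [hg, StrictMono, div_lt_div_iff_of_pos_right hn, add_lt_add_iff_right,
        Nat.cast_lt, Fin.val_fin_lt]
    change ((∀ i, w (x i) = v i) ∧ StrictMono fun i => (g (x i)).2) ↔ _
    rw [this, and_comm]
  refine Nat.card_congr
    { toFun := fun x => ⟨OrderEmbedding.ofStrictMono x.1 ((hmem _).1 x.2).1, ((hmem _).1 x.2).2⟩
      invFun := fun j => ⟨j.1, (hmem _).2 ⟨j.1.strictMono, j.2⟩⟩
      left_inv := fun x => rfl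
      right_inv := fun j => by ext; rfl }

theorem tendsto_pow_div_choose (k : ℕ) :
    Tendsto (fun n : ℕ => (n : ℝ) ^ k / (n.choose k : ℝ)) atTop (𝓝 k.factorial) := by
  have hz : ∀ᶠ n : ℕ in atTop, ((n : ℝ) ^ k / k.factorial) ≠ 0 := by
    filter_upwards [eventually_gt_atTop 0] with n hn
    positivity
  have h := ((Asymptotics.isEquivalent_iff_tendsto_one hz).1
    (isEquivalent_choose k)).inv₀ one_ne_zero |>.const_mul (k.factorial : ℝ)
  rw [inv_one, mul_one] at h
  refine h.congr fun n => ?_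
  have : (k.factorial : ℝ) ≠ 0 := by positivity
  simp only [Pi.div_apply, inv_div]
  field_simp

/-- Densities converge to the `spread` of the weak limit. -/
theorem tendsto_density {A : Type*} [Finite A] [TopologicalSpace A] [DiscreteTopology A]
    [MeasurableSpace A] [BorelSpace A] {ι : Type*} {L : Filter ι}
    {len : ι → ℕ} [∀ n, NeZero (len n)] {w : ∀ n, Fin (len n) → A}
    (hlen : Tendsto len L atTop) {ρ : ProbabilityMeasure (A × ℝ)}
    (hρ : (ρ : Measure (A × ℝ)).map Prod.snd = volume.restrict (Set.Icc (0 : ℝ) 1))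
    (h : Tendsto (fun n => wordMeasure (w n)) L (𝓝 ρ)) {k : ℕ} (v : Fin k → A) :
    Tendsto (fun n => density v (w n)) L (𝓝 ((spread ρ k {v} : ℝ≥0) : ℝ)) := by
  have hpi : Tendsto (fun n => ProbabilityMeasure.pi fun _ : Fin k => wordMeasure (w n)) L
      (𝓝 (ProbabilityMeasure.pi fun _ : Fin k => ρ)) :=
    (ProbabilityMeasure.continuous_pi.tendsto fun _ => ρ).comp (tendsto_pi_nhds.2 fun _ => h)
  -- Portmanteau condition: only the limit needs almost surely distinct positions; the empirical
  -- measures do have ties.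
  have hfr : (ProbabilityMeasure.pi fun _ : Fin k => ρ : Measure (Fin k → A × ℝ))
      (frontier (orderedSet v)) = 0 :=
    measure_mono_null (frontier_orderedSet_subset v) (ae_iff.1 (ae_injective_snd hρ k))
  have h1 := (ENNReal.tendsto_toReal (measure_ne_top _ _)).comp
    (ProbabilityMeasure.tendsto_measure_of_null_frontier_of_tendsto' hpi hfr)
  have h2 := ((tendsto_pow_div_choose k).comp hlen).mul h1
  have h3 : ((spread ρ k {v} : ℝ≥0) : ℝ) = k.factorial *
      ((ProbabilityMeasure.pi fun _ : Fin k => ρ : Measure (Fin k → A × ℝ))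
        (orderedSet v)).toReal := by
    change ((spread ρ k : Measure (Fin k → A)) {v}).toReal = _
    rw [spread_singleton hρ, ENNReal.toReal_mul, ENNReal.toReal_natCast]
    rfl
  rw [h3]
  refine h2.congr fun n => ?_
  have h4 : (ProbabilityMeasure.pi fun _ : Fin k => wordMeasure (w n) :
      Measure (Fin k → A × ℝ)) (orderedSet v) =
        subseqCount v (w n) * ((len n : ℝ≥0∞)⁻¹) ^ k := pi_wordMeasureAux_orderedSet (w n) v
  have hn : (len n : ℝ) ≠ 0 := by exact_mod_cast NeZero.ne (len n)
  simp only [Function.comp_apply, h4, density, ENNReal.toReal_mul, ENNReal.toReal_pow,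
    ENNReal.toReal_inv, ENNReal.toReal_natCast, inv_pow]
  field_simp

/-! ### The spread determines the measure -/

/-- The last letter is that of the sample with the largest position. Any of `r + 1` samples may be
it, and the other `r` fall below position `x` with probability `x ^ r`. -/
theorem sum_spread_last {A : Type*} [Fintype A] [DecidableEq A] [TopologicalSpace A]
    [DiscreteTopology A] [MeasurableSpace A] [BorelSpace A] {ρ : ProbabilityMeasure (A × ℝ)}
    (hρ : (ρ : Measure (A × ℝ)).map Prod.snd = volume.restrict (Set.Icc (0 : ℝ) 1))
    (a : A) (r : ℕ) :
    ∑ v : Fin (r + 1) → A with v (Fin.last r) = a,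
        (spread ρ (r + 1) : Measure (Fin (r + 1) → A)) {v} =
      (r + 1) * ∫⁻ q in {q | q.1 = a}, ENNReal.ofReal q.2 ^ r ∂(ρ : Measure (A × ℝ)) := by
  have hma : MeasurableSet {q : A × ℝ | q.1 = a} := measurable_fst (measurableSet_singleton a)
  set B : Fin (r + 1) → Set (Fin (r + 1) → A × ℝ) := fun i =>
    {p | (p i).1 = a ∧ ∀ j, (p (i.succAbove j)).2 < (p i).2} with hB
  set C : Set ((A × ℝ) × (Fin r → A × ℝ)) := {q | q.1.1 = a ∧ ∀ j, (q.2 j).2 < q.1.2} with hC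
  have hCm : MeasurableSet C := by
    have : C = {q | q.1.1 ∈ ({a} : Set A)} ∩ ⋂ j, {q | (q.2 j).2 < q.1.2} := by
      ext q; simp [hC]
    rw [this]
    refine MeasurableSet.inter
      (measurable_fst.fst (measurableSet_singleton a)) (MeasurableSet.iInter fun j => ?_)
    exact measurableSet_lt (by fun_prop) (by fun_prop)
  have hBC : ∀ i, B i =
      MeasurableEquiv.piFinSuccAbove (fun _ : Fin (r + 1) => A × ℝ) i ⁻¹' C := fun i => rfl
  have hBm : ∀ i, MeasurableSet (B i) := fun i => by
    rw [hBC]; exact (MeasurableEquiv.measurable _) hCm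
  have hBi : ∀ i, Measure.pi (fun _ : Fin (r + 1) => (ρ : Measure (A × ℝ))) (B i) =
      ∫⁻ q in {q | q.1 = a}, ENNReal.ofReal q.2 ^ r ∂(ρ : Measure (A × ℝ)) := by
    intro i
    rw [hBC, (measurePreserving_piFinSuccAbove
      (fun _ : Fin (r + 1) => (ρ : Measure (A × ℝ))) i).measure_preimage hCm.nullMeasurableSet,
      Measure.prod_apply hCm, ← lintegral_indicator hma]
    refine lintegral_congr_ae ?_
    filter_upwards [ae_snd_mem_Icc hρ] with q hq
    by_cases hqa : q.1 = a
    · have : Prod.mk q ⁻¹' C = Set.univ.pi fun _ => {x : A × ℝ | x.2 < q.2} := by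
        ext x; simp [hC, hqa]
      rw [Set.indicator_of_mem (by exact hqa), this, Measure.pi_pi]
      simp [measure_snd_lt hρ hq]
    · have : Prod.mk q ⁻¹' C = ∅ := by
        ext x; simp [hC, hqa]
      rw [Set.indicator_of_notMem (by exact hqa), this, measure_empty]
  have hdisj : Pairwise fun i j => Disjoint (B i) (B j) := by
    intro i j hij
    refine Set.disjoint_left.2 fun p hi hj => ?_
    obtain ⟨l, hl⟩ := Fin.exists_succAbove_eq hij
    obtain ⟨m, hm⟩ := Fin.exists_succAbove_eq hij.symm
    have h1 := hi.2 m
    have h2 := hj.2 l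
    rw [hm] at h1; rw [hl] at h2
    exact lt_asymm h1 h2
  have hsum : Measure.pi (fun _ : Fin (r + 1) => (ρ : Measure (A × ℝ))) (⋃ i, B i) =
      (r + 1) * ∫⁻ q in {q | q.1 = a}, ENNReal.ofReal q.2 ^ r ∂(ρ : Measure (A × ℝ)) := by
    rw [measure_iUnion hdisj hBm, tsum_fintype]
    simp [hBi]
  rw [← hsum, sum_measure_singleton]
  change (Measure.map _ _) _ = _
  rw [Measure.map_apply (measurable_inducedOrderStat _) (Finset.measurableSet _)]
  refine measure_congr ?_
  filter_upwards [ae_injective_snd hρ (r + 1)] with p hp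
  refine propext ?_
  change inducedOrderStat _ _ ∈ _ ↔ p ∈ ⋃ i, B i
  set x : Fin (r + 1) → ℝ := fun i => (p i).2 with hx
  have hsm : StrictMono (x ∘ Tuple.sort x) :=
    (Tuple.monotone_sort x).strictMono_of_injective (hp.comp (Equiv.injective _))
  have hlast : ∀ i, (∀ j, x (i.succAbove j) < x i) ↔ Tuple.sort x (Fin.last r) = i := by
    intro i
    constructor
    · intro h
      by_contra hne
      obtain ⟨j, hj⟩ := Fin.exists_succAbove_eq hne
      have h1 := h j
      rw [hj] at h1
      have h2 := hsm.monotone (Fin.le_last ((Tuple.sort x).symm i))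
      simp at h2
      exact absurd h1 (not_lt.2 h2)
    · rintro rfl j
      obtain ⟨l, hl⟩ := (Tuple.sort x).surjective ((Tuple.sort x (Fin.last r)).succAbove j)
      have : l ≠ Fin.last r := by
        rintro rfl
        exact Fin.succAbove_ne _ _ hl.symm
      rw [← hl]
      exact hsm (Fin.lt_last_iff_ne_last.2 this)
  have hmemB : ∀ i, p ∈ B i ↔ (p i).1 = a ∧ Tuple.sort x (Fin.last r) = i := by
    intro i; rw [← hlast i]; rfl
  simp [hmemB, inducedOrderStat]

/-- Determinacy of the moment problem on `[0,1]`, by Weierstrass approximation of continuous test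
functions. -/
theorem measure_eq_of_moments {μ ν : Measure ℝ} [IsFiniteMeasure μ] [IsFiniteMeasure ν]
    (hμ : ∀ᵐ x ∂μ, x ∈ Set.Icc (0 : ℝ) 1) (hν : ∀ᵐ x ∂ν, x ∈ Set.Icc (0 : ℝ) 1)
    (h : ∀ r : ℕ, ∫⁻ x, ENNReal.ofReal x ^ r ∂μ = ∫⁻ x, ENNReal.ofReal x ^ r ∂ν) : μ = ν := by
  have hpint : ∀ (κ : Measure ℝ) [IsFiniteMeasure κ], (∀ᵐ x ∂κ, x ∈ Set.Icc (0 : ℝ) 1) →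
      ∀ f : ℝ → ℝ, Continuous f → Integrable f κ := by
    intro κ _ hκ f hf
    obtain ⟨C, hC⟩ := isCompact_Icc.exists_bound_of_continuousOn (hf.continuousOn (s := Set.Icc 0 1))
    refine Integrable.of_bound hf.aestronglyMeasurable C ?_
    filter_upwards [hκ] with x hx using hC x hx
  have hmom : ∀ (κ : Measure ℝ), (∀ᵐ x ∂κ, x ∈ Set.Icc (0 : ℝ) 1) →
      ∀ r : ℕ, ∫ x, x ^ r ∂κ = (∫⁻ x, ENNReal.ofReal x ^ r ∂κ).toReal := by
    intro κ hκ r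
    rw [integral_eq_lintegral_of_nonneg_ae _ (by fun_prop)]
    · congr 1
      refine lintegral_congr_ae ?_
      filter_upwards [hκ] with x hx using ENNReal.ofReal_pow hx.1 r
    · filter_upwards [hκ] with x hx using pow_nonneg hx.1 r
  have hpoly : ∀ p : Polynomial ℝ, ∫ x, p.eval x ∂μ = ∫ x, p.eval x ∂ν := by
    intro p
    induction p using Polynomial.induction_on' with
    | add p q hp hq =>
      simp only [Polynomial.eval_add]
      rw [integral_add (hpint μ hμ _ p.continuous) (hpint μ hμ _ q.continuous),
        integral_add (hpint ν hν _ p.continuous) (hpint ν hν _ q.continuous), hp, hq]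
    | monomial r c =>
      simp only [Polynomial.eval_monomial, integral_const_mul, hmom μ hμ, hmom ν hν, h]
  refine ext_of_forall_integral_eq_of_IsFiniteMeasure (μ := μ) (ν := ν) fun f => ?_
  have hbd : ∀ ε > 0, |∫ x, f x ∂μ - ∫ x, f x ∂ν| ≤ ε * (μ.real Set.univ + ν.real Set.univ) := by
    intro ε hε
    obtain ⟨p, hp⟩ := exists_polynomial_near_of_continuousOn 0 1 f f.continuous.continuousOn ε hε
    have key : ∀ (κ : Measure ℝ) [IsFiniteMeasure κ], (∀ᵐ x ∂κ, x ∈ Set.Icc (0 : ℝ) 1) →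
        |∫ x, f x ∂κ - ∫ x, p.eval x ∂κ| ≤ ε * κ.real Set.univ := by
      intro κ _ hκ
      rw [← integral_sub (hpint κ hκ _ f.continuous) (hpint κ hκ _ p.continuous),
        ← Real.norm_eq_abs]
      refine norm_integral_le_of_norm_le_const (μ := κ) ?_
      filter_upwards [hκ] with x hx
      rw [Real.norm_eq_abs, abs_sub_comm]
      exact (hp x hx).le
    have h1 := key μ hμ
    have h2 := key ν hν
    rw [hpoly p] at h1
    rw [abs_le] at *
    constructor <;> linarith [h1.1, h1.2, h2.1, h2.2]
  have hlim : Tendsto (fun ε : ℝ => ε * (μ.real Set.univ + ν.real Set.univ)) (𝓝[>] 0) (𝓝 0) := by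
    have : Tendsto (fun ε : ℝ => ε * (μ.real Set.univ + ν.real Set.univ)) (𝓝 0)
        (𝓝 (0 * (μ.real Set.univ + ν.real Set.univ))) :=
      (continuous_id.mul continuous_const).tendsto 0
    rw [zero_mul] at this
    exact this.mono_left nhdsWithin_le_nhds
  have h0 : |∫ x, f x ∂μ - ∫ x, f x ∂ν| ≤ 0 :=
    ge_of_tendsto hlim (eventually_nhdsWithin_of_forall fun ε hε => hbd ε hε)
  exact sub_eq_zero.1 (abs_nonpos_iff.1 h0)

theorem eq_of_spread_eq {A : Type*} [Finite A] [TopologicalSpace A] [DiscreteTopology A]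
    [MeasurableSpace A] [BorelSpace A] {ρ ρ' : ProbabilityMeasure (A × ℝ)}
    (hρ : (ρ : Measure (A × ℝ)).map Prod.snd = volume.restrict (Set.Icc (0 : ℝ) 1))
    (hρ' : (ρ' : Measure (A × ℝ)).map Prod.snd = volume.restrict (Set.Icc (0 : ℝ) 1))
    (h : ∀ k : ℕ, 1 ≤ k → ∀ v : Fin k → A, spread ρ k {v} = spread ρ' k {v}) : ρ = ρ' := by
  classical
  have := Fintype.ofFinite A
  have hma : ∀ a, MeasurableSet {q : A × ℝ | q.1 = a} := fun a =>
    measurable_fst (measurableSet_singleton a)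
  have hfib : ∀ a, ((ρ : Measure (A × ℝ)).restrict {q | q.1 = a}).map Prod.snd =
      ((ρ' : Measure (A × ℝ)).restrict {q | q.1 = a}).map Prod.snd := by
    intro a
    have hae : ∀ {κ : ProbabilityMeasure (A × ℝ)},
        (κ : Measure (A × ℝ)).map Prod.snd = volume.restrict (Set.Icc (0 : ℝ) 1) →
        ∀ᵐ x ∂(((κ : Measure (A × ℝ)).restrict {q | q.1 = a}).map Prod.snd),
          x ∈ Set.Icc (0 : ℝ) 1 := fun {κ} hκ =>
      (ae_map_iff measurable_snd.aemeasurable measurableSet_Icc).2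
        (ae_restrict_of_ae (ae_snd_mem_Icc hκ))
    refine measure_eq_of_moments (hae hρ) (hae hρ') fun r => ?_
    have hs := sum_spread_last hρ a r
    have hs' := sum_spread_last hρ' a r
    have heq : ∀ v : Fin (r + 1) → A, (spread ρ (r + 1) : Measure (Fin (r + 1) → A)) {v} =
        (spread ρ' (r + 1) : Measure (Fin (r + 1) → A)) {v} := fun v => by
      rw [← ProbabilityMeasure.ennreal_coeFn_eq_coeFn_toMeasure,
        ← ProbabilityMeasure.ennreal_coeFn_eq_coeFn_toMeasure, h _ (Nat.succ_pos r) v]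
    simp only [heq] at hs
    have hmul := hs.symm.trans hs'
    rw [ENNReal.mul_right_inj (by positivity) (by finiteness)] at hmul
    rwa [lintegral_map (by fun_prop) measurable_snd, lintegral_map (by fun_prop) measurable_snd]
  refine Subtype.ext (Measure.ext fun s hs => ?_)
  have hdec : ∀ κ : Measure (A × ℝ), κ s =
      ∑ a, ((κ.restrict {q | q.1 = a}).map Prod.snd) {x | (a, x) ∈ s} := by
    intro κ
    have hU : s = ⋃ a, (Prod.snd ⁻¹' {x : ℝ | (a, x) ∈ s} ∩ {q : A × ℝ | q.1 = a}) := by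
      ext ⟨b, x⟩; simp
    have hms : ∀ a, MeasurableSet {x : ℝ | (a, x) ∈ s} := fun a => measurable_prodMk_left hs
    conv_lhs => rw [hU]
    rw [measure_iUnion, tsum_fintype]
    · refine Finset.sum_congr rfl fun a _ => ?_
      rw [Measure.map_apply measurable_snd (hms a), Measure.restrict_apply (measurable_snd (hms a))]
    · intro a b hab
      exact Set.disjoint_left.2 fun q h1 h2 => hab (h1.2.symm.trans h2.2)
    · exact fun a => (measurable_snd (hms a)).inter (hma a)
  change (ρ : Measure (A × ℝ)) s = (ρ' : Measure (A × ℝ)) s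
  rw [hdec, hdec (ρ' : Measure (A × ℝ))]
  simp [hfib]

/-! ### Limits of empirical measures -/

/-- All positions are positive, so only the cut at `t` matters. Leaving `s` free covers both `Icc 0
t` and `Iic t`. -/
theorem wordMeasureAux_univ_prod {A : Type*} [MeasurableSpace A] {n : ℕ} [NeZero n]
    (w : Fin n → A) {t : ℝ} (ht : t ∈ Set.Icc (0 : ℝ) 1) {s : Set ℝ} (hs : MeasurableSet s)
    (h1 : Set.Icc 0 t ⊆ s) (h2 : s ⊆ Set.Iic t) :
    wordMeasureAux w (Set.univ ×ˢ s) = ENNReal.ofReal ((⌊t * n⌋₊ : ℝ) / n) := by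
  have hn : (0 : ℝ) < n := by exact_mod_cast Nat.pos_of_neZero n
  have hle : ⌊t * n⌋₊ ≤ n := by
    refine Nat.floor_le_of_le ?_
    nlinarith [ht.2]
  have hmem : ∀ j : Fin n,
      (w j, (((j : ℕ) : ℝ) + 1) / (n : ℝ)) ∈ Set.univ ×ˢ s ↔ (j : ℕ) < ⌊t * n⌋₊ := by
    intro j
    have hpos : 0 ≤ (((j : ℕ) : ℝ) + 1) / (n : ℝ) := by positivity
    have hs' : (((j : ℕ) : ℝ) + 1) / (n : ℝ) ∈ s ↔ (((j : ℕ) : ℝ) + 1) / (n : ℝ) ≤ t :=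
      ⟨fun h => h2 h, fun h => h1 ⟨hpos, h⟩⟩
    rw [Set.mem_prod, and_iff_right (Set.mem_univ _), hs', div_le_iff₀ hn, ← Nat.succ_le_iff,
      Nat.le_floor_iff (mul_nonneg ht.1 hn.le), Nat.cast_succ]
  have hcard : Nat.card {j : Fin n // (w j, (((j : ℕ) : ℝ) + 1) / (n : ℝ)) ∈ Set.univ ×ˢ s} =
      ⌊t * n⌋₊ := by
    rw [← Nat.card_fin ⌊t * n⌋₊]
    exact Nat.card_congr
      { toFun := fun j => ⟨j.1, (hmem _).1 j.2⟩
        invFun := fun j => ⟨⟨j, j.2.trans_le hle⟩, (hmem _).2 j.2⟩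
        left_inv := fun j => rfl
        right_inv := fun j => rfl }
  rw [wordMeasureAux_apply w (MeasurableSet.univ.prod hs), hcard, ENNReal.ofReal_div_of_pos hn,
    ENNReal.ofReal_natCast, ENNReal.ofReal_natCast, mul_comm, div_eq_mul_inv]

/-- Portmanteau on closed sets gives the lower bound and on open sets the upper bound. The filter is
general so that the result applies along ultrafilters converging to a cluster point. -/
theorem mem_uniformSecondMarginal_of_tendsto {A : Type*} [Finite A] [TopologicalSpace A]
    [DiscreteTopology A] [MeasurableSpace A] [BorelSpace A] {ι : Type*} {L : Filter ι} [L.NeBot]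
    {len : ι → ℕ} [∀ n, NeZero (len n)] {w : ∀ n, Fin (len n) → A}
    (hlen : Tendsto len L atTop) {ρ : ProbabilityMeasure (A × ℝ)}
    (h : Tendsto (fun n => wordMeasure (w n)) L (𝓝 ρ)) : ρ ∈ uniformSecondMarginal A := by
  have hlim : ∀ t ∈ Set.Icc (0 : ℝ) 1,
      Tendsto (fun n => ENNReal.ofReal ((⌊t * len n⌋₊ : ℝ) / len n)) L (𝓝 (ENNReal.ofReal t)) :=
    fun t ht => (ENNReal.continuous_ofReal.tendsto t).comp
      ((tendsto_nat_floor_mul_div_atTop ht.1).comp (tendsto_natCast_atTop_atTop.comp hlen))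
  have hlow : ∀ t ∈ Set.Icc (0 : ℝ) 1,
      ENNReal.ofReal t ≤ (ρ : Measure (A × ℝ)) (Set.univ ×ˢ Set.Icc (0 : ℝ) t) := by
    intro t ht
    have h1 := ProbabilityMeasure.limsup_measure_closed_le_of_tendsto h
      (isClosed_univ.prod (isClosed_Icc (a := (0 : ℝ)) (b := t)))
    refine le_trans (le_of_eq ?_) h1
    rw [← (hlim t ht).limsup_eq]
    congr 1
    funext n
    exact (wordMeasureAux_univ_prod (w n) ht measurableSet_Icc subset_rfl
      Set.Icc_subset_Iic_self).symm
  have hup : ∀ t ∈ Set.Icc (0 : ℝ) 1,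
      (ρ : Measure (A × ℝ)) (Set.univ ×ˢ Set.Iio t) ≤ ENNReal.ofReal t := by
    intro t ht
    refine (ProbabilityMeasure.le_liminf_measure_open_of_tendsto h
      (isOpen_univ.prod (isOpen_Iio (a := t)))).trans ?_
    rw [← (hlim t ht).liminf_eq]
    refine liminf_le_liminf (Eventually.of_forall fun n => ?_)
    change wordMeasureAux (w n) _ ≤ _
    rw [← wordMeasureAux_univ_prod (w n) ht measurableSet_Iic Set.Icc_subset_Iic_self subset_rfl]
    exact measure_mono (Set.prod_mono subset_rfl Set.Iio_subset_Iic_self)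
  intro t ht
  refine le_antisymm ?_ (hlow t ht)
  -- For `t < 1`, enclose `Icc 0 t` in `Iio u` and let `u` decrease to `t`; at `t = 1` no such `u ≤
  -- 1` exists, but total mass one suffices.
  rcases ht.2.eq_or_lt with rfl | ht1
  · simpa using prob_le_one
  · have hl : Tendsto ENNReal.ofReal (𝓝[>] t) (𝓝 (ENNReal.ofReal t)) :=
      (ENNReal.continuous_ofReal.tendsto t).mono_left nhdsWithin_le_nhds
    refine ge_of_tendsto hl ?_
    filter_upwards [Ioo_mem_nhdsGT ht1] with u hu
    refine le_trans (measure_mono (Set.prod_mono subset_rfl fun x hx => ?_))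
      (hup u ⟨ht.1.trans hu.1.le, hu.2.le⟩)
    exact hx.2.trans_lt hu.1

theorem isTightMeasureSet_range_wordMeasure {A : Type*} [Finite A] [TopologicalSpace A]
    [DiscreteTopology A] [MeasurableSpace A] [BorelSpace A] {ι : Type*}
    {len : ι → ℕ} [∀ n, NeZero (len n)] (w : ∀ n, Fin (len n) → A) :
    IsTightMeasureSet {((μ : ProbabilityMeasure (A × ℝ)) : Measure (A × ℝ)) |
      μ ∈ Set.range fun n => wordMeasure (w n)} := by
  rw [isTightMeasureSet_iff_exists_isCompact_measure_compl_le]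
  refine fun ε _ => ⟨Set.univ ×ˢ Set.Icc 0 1, Set.finite_univ.isCompact.prod isCompact_Icc, ?_⟩
  rintro _ ⟨_, ⟨n, rfl⟩, rfl⟩
  refine le_trans (le_of_eq ?_) zero_le
  rw [prob_compl_eq_zero_iff (MeasurableSet.univ.prod measurableSet_Icc)]
  have hn : (len n : ℝ) ≠ 0 := by exact_mod_cast NeZero.ne (len n)
  change wordMeasureAux (w n) _ = 1
  have := wordMeasureAux_univ_prod (w n) (t := 1) (by simp) measurableSet_Icc subset_rfl
    Set.Icc_subset_Iic_self
  simpa [hn] using this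

end WordLimits

theorem mainTheorem7 {A : Type*} [Finite A] [TopologicalSpace A] [DiscreteTopology A]
    [MeasurableSpace A] [BorelSpace A]
    (len : ℕ → ℕ) [∀ n, NeZero (len n)] (w : ∀ n, Fin (len n) → A)
    (hlen : Tendsto len atTop atTop) :
    ((∀ k : ℕ, 1 ≤ k → ∀ v : Fin k → A,
        ∃ c : ℝ, Tendsto (fun n => WordLimits.density v (w n)) atTop (𝓝 c)) ↔
      ∃ ρ ∈ WordLimits.uniformSecondMarginal A,
        Tendsto (fun n => WordLimits.wordMeasure (w n)) atTop (𝓝 ρ)) ∧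
    (∀ ρ ∈ WordLimits.uniformSecondMarginal A,
      Tendsto (fun n => WordLimits.wordMeasure (w n)) atTop (𝓝 ρ) →
      ∀ k : ℕ, 1 ≤ k → ∀ v : Fin k → A,
        Tendsto (fun n => WordLimits.density v (w n)) atTop
          (𝓝 ((WordLimits.spread ρ k {v} : ℝ≥0) : ℝ))) := by
  have hdens : ∀ ρ ∈ WordLimits.uniformSecondMarginal A,
      Tendsto (fun n => WordLimits.wordMeasure (w n)) atTop (𝓝 ρ) →
      ∀ k : ℕ, 1 ≤ k → ∀ v : Fin k → A,
        Tendsto (fun n => WordLimits.density v (w n)) atTop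
          (𝓝 ((WordLimits.spread ρ k {v} : ℝ≥0) : ℝ)) :=
    fun ρ hρ h k _ v => WordLimits.tendsto_density hlen
      (WordLimits.map_snd_eq_of_mem_uniformSecondMarginal hρ) h v
  refine ⟨⟨fun hconv => ?_, ?_⟩, hdens⟩
  · have hK := isCompact_closure_of_isTightMeasureSet
      (WordLimits.isTightMeasureSet_range_wordMeasure w)
    have hmem : ∀ n, WordLimits.wordMeasure (w n) ∈
        closure (Set.range fun n => WordLimits.wordMeasure (w n)) :=
      fun n => subset_closure ⟨n, rfl⟩
    have hcluster : ∀ ρ, MapClusterPt ρ atTop (fun n => WordLimits.wordMeasure (w n)) →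
        ρ ∈ WordLimits.uniformSecondMarginal A ∧ ∀ k : ℕ, 1 ≤ k → ∀ v : Fin k → A, ∀ c : ℝ,
          Tendsto (fun n => WordLimits.density v (w n)) atTop (𝓝 c) →
            ((WordLimits.spread ρ k {v} : ℝ≥0) : ℝ) = c := by
      intro ρ hρ
      -- The ultrafilter plays the role of a convergent subsequence, along which the density limits
      -- persist.
      obtain ⟨U, hU, hUρ⟩ := mapClusterPt_iff_ultrafilter.1 hρ
      have hmemρ := WordLimits.mem_uniformSecondMarginal_of_tendsto (hlen.mono_left hU) hUρ
      exact ⟨hmemρ, fun k _ v c hc => tendsto_nhds_unique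
        (WordLimits.tendsto_density (hlen.mono_left hU)
          (WordLimits.map_snd_eq_of_mem_uniformSecondMarginal hmemρ) hUρ v) (hc.mono_left hU)⟩
    obtain ⟨ρ, -, hρ⟩ := hK.exists_mapClusterPt (f := atTop)
      (u := fun n => WordLimits.wordMeasure (w n)) (by simpa using ⟨0, fun n _ => hmem n⟩)
    refine ⟨ρ, (hcluster ρ hρ).1, hK.tendsto_nhds_of_unique_mapClusterPt
      (Eventually.of_forall hmem) fun ρ' _ hρ' => ?_⟩
    refine WordLimits.eq_of_spread_eq
      (WordLimits.map_snd_eq_of_mem_uniformSecondMarginal (hcluster ρ' hρ').1)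
      (WordLimits.map_snd_eq_of_mem_uniformSecondMarginal (hcluster ρ hρ).1) fun k hk v => ?_
    obtain ⟨c, hc⟩ := hconv k hk v
    exact NNReal.coe_injective
      (((hcluster ρ' hρ').2 k hk v c hc).trans ((hcluster ρ hρ).2 k hk v c hc).symm)
  · rintro ⟨ρ, hρ, h⟩ k hk v
    exact ⟨_, hdens ρ hρ h k hk v⟩
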